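/- **Setting.** Let $d,K\ge 1$ and let $D\subset\mathbb R^d$ be bounded, open and connected with Lipschitz boundary. Let $\nu$ be a probability measure on $D$ with Lebesgue density $\rho$ that is Lipschitz on $D$ and bounded above and below by positive constants; if $d=1$ and $D=(a,b)$, assume also that $\rho$ is differentiable on $D$, nondecreasing on some interval with left endpoint $a$ and nonincreasing on some interval with right endpoint $b$. Let $\eta:\mathbb R^d\to\mathbb R$ satisfy $\int\eta=1$, $\eta(z)\le\eta(z_0)$ whenever $\|z\|\ge\|z_0\|$, $\eta(0)>0$, be continuous at $0$ and compactly supported. Let $\alpha\in\mathbb R$ and let $\epsilon_n>0$, $\epsilon_n\to0$, satisfy: if $\alpha\in\{0,1\}$, then as $n\to\infty$ $$\tfrac{\sqrt{2\log\log n}}{\sqrt n\,\epsilon_n}\to0\ (d=1),\qquad \tfrac{(\log n)^{3/4}}{n^{1/2}\epsilon_n}\to0\ (d=2),\qquad \tfrac{(\log n)^{1/d}}{n^{1/d}\epsilon_n}\to0\ (d\ge3);$$ if $\alpha\ne0,1$, then $\sum_n n\exp(-n\epsilon_n^{d+1})<\infty$. Let $X_1,X_2,\dots$ be i.i.d. with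 law $\nu$ and $\mathcal X_n=\{X_1,\dots,X_n\}$. Put $W_{ij}=\epsilon_n^{-d}\,\eta((X_i-X_j)/\epsilon_n)$ for $i\ne j$, $W_{ii}=0$, $d_i=\sum_jW_{ij}$, $2m=\sum_id_i$, $S=\sum_id_i^\alpha$. For a partition of $\mathcal X_n$ given by labels $c_1,\dots,c_n\in\{1,\dots,K\}$ (classes may be empty) let $$Q_n=\frac1{2m}\sum_{i,j}\Big(W_{ij}-2m\frac{d_i^\alpha d_j^\alpha}{S^2}\Big)\mathbf 1_{\{c_i=c_j\}}.$$ A partition of $\mathcal X_n$ into at most $K$ classes is *optimal* if it maximizes $Q_n$ among all such partitions. Let $d\mu=\rho^{1+\alpha}dx/\int_D\rho^{1+\alpha}dx$. A *continuum optimal partition* is a partition $\mathcal U^*=\{U^*_k\}_{k=1}^K$ of $D$ into measurable sets with $\mu(U_k^*)=1/K$ for all $k$ that minimizes $\frac12\sum_k\mathrm{Per}(U_k;\rho^2)$ among all such partitions, where $$\mathrm{Per}(U;\rho^2)=\sup\Big\{\int_U\operatorname{div}\Phi\,dx:\ \Phi\in C^1_c(D;\mathbb R^d),\ |\Phi|\le\rho^2\Big\}.$$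 Let $n_1<n_2<\cdots$, let $\{U^*_{n_m,k}\}_{k=1}^K$ be optimal partitions of $\mathcal X_{n_m}$, and let $\pi_{n_m}$ be permutations of $\{1,\dots,K\}$ (all of these may depend on the realization). We say that $\mathcal U^*_{n_m}$ *converges weakly* to $\mathcal U^*$ (with the matching $\pi_{n_m}$) if, for each $k$, the measures $$\frac1{n_m}\sum_{i=1}^{n_m}\delta_{(X_i,\ \mathbf 1[X_i\in U^*_{n_m,\pi_{n_m}(k)}])}$$ converge weakly, as $m\to\infty$, to the law of $(X,\mathbf 1_{U_k^*}(X))$, $X\sim\nu$. **Corollary 2.2.** Suppose that almost surely $\mathcal U^*_{n_m}$ converges weakly to $\mathcal U^*$ with the matching $\pi_{n_m}$, where either (i) $\mathcal U^*$ is a fixed (nonrandom) continuum optimal partition, or (ii) $\mathcal U^*$ depends on the realization, is almost surely a continuum optimal partition, and almost surely $\nu(\partial U^*_k)=0$ for all $k$. Then, almost surely as $m\to\infty$, $$p_{n_m}:=\max_{1\le k\le K}\frac{|\{x\in\mathcal X_{n_m}:x\in U_k^*\cap U^*_{n_m,\pi_{n_m}(k)}\}|}{|\{x\in\mathcal X_{n_m}:x\in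 U^*_k\}|}\to1 ;$$ moreover, the ratio converges to $1$ for every single $k$, and so does the overall fraction of correctly classified points, $$\frac1{n_m}\Big|\Big\{x\in\mathcal X_{n_m}:\ x\in U_k^*\cap U^*_{n_m,\pi_{n_m}(k)}\text{ for some }k\Big\}\Big|\to1 .$$ -/

import Mathlib

open MeasureTheory ProbabilityTheory Filter Topology Set
open scoped BoundedContinuousFunction ENNReal

noncomputable section

namespace GeomModularity

/-! Weighted graphs and modularity -/

/-- Degree of vertex `i` in the graph with weight matrix `W`. -/
def degree {n : ℕ} (W : Matrix (Fin n) (Fin n) ℝ) (i : Fin n) : ℝ :=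
  ∑ j, W i j

/-- Total edge weight, each undirected edge being counted once. -/
def totalWeight {n : ℕ} (W : Matrix (Fin n) (Fin n) ℝ) : ℝ :=
  (1 / 2) * ∑ i, degree W i

/-- The normalisation `S = ∑ i, d_i ^ α`. -/
def degreeSum {n : ℕ} (α : ℝ) (W : Matrix (Fin n) (Fin n) ℝ) : ℝ :=
  ∑ i, degree W i ^ α

/-- The `α`-modularity of the partition of the vertex set into the (possibly empty)
classes `{i | c i = k}`, `k : Fin K`. -/
def modularity {n K : ℕ} (α : ℝ) (W : Matrix (Fin n) (Fin n) ℝ) (c : Fin n → Fin K) : ℝ :=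
  1 / (2 * totalWeight W) * ∑ i, ∑ j,
    (W i j - 2 * totalWeight W * (degree W i ^ α * degree W j ^ α / degreeSum α W ^ 2)) *
      (if c i = c j then 1 else 0)

/-- The partition given by the labelling `c` maximises the modularity among all partitions
of the vertex set into at most `K` classes. -/
def IsOptimalClustering {n K : ℕ} (α : ℝ) (W : Matrix (Fin n) (Fin n) ℝ)
    (c : Fin n → Fin K) : Prop :=
  ∀ c' : Fin n → Fin K, modularity α W c' ≤ modularity α W c

/-- Weight matrix of the geometric graph on the points `x 0, …, x (n - 1)` with kernel `η`
and length scale `ε`. -/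
def geometricWeights {d : ℕ} (η : EuclideanSpace ℝ (Fin d) → ℝ) (ε : ℝ)
    (x : ℕ → EuclideanSpace ℝ (Fin d)) (n : ℕ) : Matrix (Fin n) (Fin n) ℝ :=
  fun i j => if i = j then 0 else 1 / ε ^ d * η (ε⁻¹ • (x i - x j))

/-! Standing assumptions -/

/-- The boundary of `D` is Lipschitz: near each of its points, `D` is the set above the graph
of a Lipschitz function, in some orthogonal coordinate system with vertical unit vector `e`. -/
def HasLipschitzBoundary {d : ℕ} (D : Set (EuclideanSpace ℝ (Fin d))) : Prop :=
  ∀ p ∈ frontier D, ∃ (e : EuclideanSpace ℝ (Fin d)) (g : (Submodule.span ℝ {e})ᗮ → ℝ)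
    (L : NNReal) (r : ℝ), ‖e‖ = 1 ∧ LipschitzWith L g ∧ 0 < r ∧
      ∀ x ∈ Metric.ball p r,
        (x ∈ D ↔ g ((Submodule.span ℝ {e})ᗮ.orthogonalProjectionOnto x) < inner ℝ e x)

/-- Assumptions on the domain. -/
structure IsAdmissibleDomain {d : ℕ} (D : Set (EuclideanSpace ℝ (Fin d))) : Prop where
  isOpen : IsOpen D
  isConnected : IsConnected D
  isBounded : Bornology.IsBounded D
  lipschitzBoundary : HasLipschitzBoundary D

/-- The measure on `D` with Lebesgue density `ρ`. -/
def groundMeasure {d : ℕ} (D : Set (EuclideanSpace ℝ (Fin d)))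
    (ρ : EuclideanSpace ℝ (Fin d) → ℝ) : Measure (EuclideanSpace ℝ (Fin d)) :=
  (volume.restrict D).withDensity fun x => ENNReal.ofReal (ρ x)

/-- Assumptions on the density `ρ` (only its values on `D` matter). In dimension one, `D` is
an interval `(a, b)` and `ρ` is moreover differentiable, nondecreasing near `a` and
nonincreasing near `b`; the unique coordinate is addressed there as "every coordinate". -/
structure IsAdmissibleDensity {d : ℕ} (D : Set (EuclideanSpace ℝ (Fin d)))
    (ρ : EuclideanSpace ℝ (Fin d) → ℝ) : Prop where
  isProbabilityMeasure : IsProbabilityMeasure (groundMeasure D ρ)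
  lipschitz : ∃ L : NNReal, LipschitzOnWith L ρ D
  bounds : ∃ a b : ℝ, 0 < a ∧ ∀ x ∈ D, a ≤ ρ x ∧ ρ x ≤ b
  oneDim : d = 1 → DifferentiableOn ℝ ρ D ∧
    ∃ a b δ : ℝ, a < b ∧ 0 < δ ∧ D = {x | ∀ i, a < x i ∧ x i < b} ∧
      (∀ x ∈ D, ∀ y ∈ D, (∀ i, x i ≤ y i) → (∀ i, y i < a + δ) → ρ x ≤ ρ y) ∧
      (∀ x ∈ D, ∀ y ∈ D, (∀ i, x i ≤ y i) → (∀ i, b - δ < x i) → ρ y ≤ ρ x)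

/-- Assumptions on the kernel; `antitone` contains radial symmetry. -/
structure IsAdmissibleKernel {d : ℕ} (η : EuclideanSpace ℝ (Fin d) → ℝ) : Prop where
  integral_eq_one : ∫ x, η x = 1
  antitone : ∀ z z₀, ‖z₀‖ ≤ ‖z‖ → η z ≤ η z₀
  pos_zero : 0 < η 0
  continuousAt_zero : ContinuousAt η 0
  hasCompactSupport : HasCompactSupport η

/-- Assumptions on the length scales `ε n`, `n ≥ 1`, in dimension `d` for the parameter `α`. -/
structure IsAdmissibleScale (d : ℕ) (α : ℝ) (ε : ℕ → ℝ) : Prop where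
  pos : ∀ n, 1 ≤ n → 0 < ε n
  tendsto_zero : Tendsto ε atTop (𝓝 0)
  rate_one : (α = 0 ∨ α = 1) → d = 1 →
    Tendsto (fun n : ℕ => √(2 * Real.log (Real.log n)) / √(n : ℝ) * (1 / ε n)) atTop (𝓝 0)
  rate_two : (α = 0 ∨ α = 1) → d = 2 →
    Tendsto (fun n : ℕ => Real.log n ^ (3 / 4 : ℝ) / (n : ℝ) ^ (1 / 2 : ℝ) * (1 / ε n))
      atTop (𝓝 0)
  rate_three : (α = 0 ∨ α = 1) → 3 ≤ d →
    Tendsto (fun n : ℕ => Real.log n ^ (1 / d : ℝ) / (n : ℝ) ^ (1 / d : ℝ) * (1 / ε n))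
      atTop (𝓝 0)
  rate_general : α ≠ 0 → α ≠ 1 →
    Summable fun n : ℕ => (n : ℝ) * Real.exp (-(n * ε n ^ (d + 1)))

/-! The continuum partitioning problem -/

/-- Divergence of a vector field. -/
def divergence {d : ℕ} (Φ : EuclideanSpace ℝ (Fin d) → EuclideanSpace ℝ (Fin d))
    (x : EuclideanSpace ℝ (Fin d)) : ℝ :=
  ∑ i, (fderiv ℝ Φ x (EuclideanSpace.single i 1)) i

/-- `Φ ∈ C¹_c(D; ℝᵈ)` and `|Φ| ≤ φ` on `D`. -/
def IsTestField {d : ℕ} (D : Set (EuclideanSpace ℝ (Fin d)))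
    (φ : EuclideanSpace ℝ (Fin d) → ℝ)
    (Φ : EuclideanSpace ℝ (Fin d) → EuclideanSpace ℝ (Fin d)) : Prop :=
  ContDiff ℝ 1 Φ ∧ HasCompactSupport Φ ∧ tsupport Φ ⊆ D ∧ ∀ x ∈ D, ‖Φ x‖ ≤ φ x

/-- Weighted total variation of `u` in `D`, with values in `[0, ∞]`. For `φ ≥ 0` the field
`Φ = 0` is admitted, so truncating negative integrals to `0` does not change the supremum. -/
def weightedTV {d : ℕ} (D : Set (EuclideanSpace ℝ (Fin d)))
    (φ u : EuclideanSpace ℝ (Fin d) → ℝ) : ℝ≥0∞ :=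
  ⨆ (Φ : EuclideanSpace ℝ (Fin d) → EuclideanSpace ℝ (Fin d)) (_ : IsTestField D φ Φ),
    ENNReal.ofReal (∫ x in D, u x * divergence Φ x)

/-- Weighted perimeter of `U` in `D`. -/
def weightedPerimeter {d : ℕ} (D : Set (EuclideanSpace ℝ (Fin d)))
    (φ : EuclideanSpace ℝ (Fin d) → ℝ) (U : Set (EuclideanSpace ℝ (Fin d))) : ℝ≥0∞ :=
  weightedTV D φ (U.indicator fun _ => 1)

/-- A partition of `D` into `K` measurable sets of `μ`-measure `1 / K`. -/
structure IsBalancedPartition {d K : ℕ} (D : Set (EuclideanSpace ℝ (Fin d)))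
    (μ : Measure (EuclideanSpace ℝ (Fin d)))
    (U : Fin K → Set (EuclideanSpace ℝ (Fin d))) : Prop where
  measurableSet : ∀ k, MeasurableSet (U k)
  disjoint : ∀ k l, k ≠ l → Disjoint (U k) (U l)
  iUnion_eq : ⋃ k, U k = D
  balanced : ∀ k, μ (U k) = 1 / (K : ℝ≥0∞)

/-- `U` minimises half the total weighted perimeter among balanced `K`-partitions of `D`. -/
def IsOptimalPartition {d K : ℕ} (D : Set (EuclideanSpace ℝ (Fin d)))
    (φ : EuclideanSpace ℝ (Fin d) → ℝ) (μ : Measure (EuclideanSpace ℝ (Fin d)))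
    (U : Fin K → Set (EuclideanSpace ℝ (Fin d))) : Prop :=
  IsBalancedPartition D μ U ∧
    ∀ V : Fin K → Set (EuclideanSpace ℝ (Fin d)), IsBalancedPartition D μ V →
      (1 / 2) * ∑ k, weightedPerimeter D φ (U k) ≤ (1 / 2) * ∑ k, weightedPerimeter D φ (V k)

/-- The probability measure on `D` with density proportional to `ρ ^ (1 + α)`. -/
def balanceMeasure {d : ℕ} (D : Set (EuclideanSpace ℝ (Fin d)))
    (ρ : EuclideanSpace ℝ (Fin d) → ℝ) (α : ℝ) : Measure (EuclideanSpace ℝ (Fin d)) :=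
  (∫⁻ x in D, ENNReal.ofReal (ρ x ^ (1 + α)))⁻¹ •
    (volume.restrict D).withDensity fun x => ENNReal.ofReal (ρ x ^ (1 + α))

/-! Weak convergence of clusters -/

/-- Weak convergence of measures, through bounded continuous test functions. -/
def ConvergesWeakly {S : Type*} [TopologicalSpace S] [MeasurableSpace S]
    (γs : ℕ → Measure S) (γ : Measure S) : Prop :=
  ∀ f : S →ᵇ ℝ, Tendsto (fun m => ∫ z, f z ∂(γs m)) atTop (𝓝 (∫ z, f z ∂γ))

/-- Graph measure of the cluster with label `k` of the points `x 0, …, x (n - 1)`: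
the uniform average of the point masses at `(x i, 1)` if `c i = k`, `(x i, 0)` otherwise. -/
def discreteGraphMeasure {d n K : ℕ} (x : ℕ → EuclideanSpace ℝ (Fin d)) (c : Fin n → Fin K)
    (k : Fin K) : Measure (EuclideanSpace ℝ (Fin d) × ℝ) :=
  (n : ℝ≥0∞)⁻¹ • ∑ i : Fin n, Measure.dirac (x i, if c i = k then (1 : ℝ) else 0)

/-- Graph measure of `U`: the distribution of the graph of the indicator of `U` under `ν`. -/
def graphMeasure {d : ℕ} (ν : Measure (EuclideanSpace ℝ (Fin d)))
    (U : Set (EuclideanSpace ℝ (Fin d))) : Measure (EuclideanSpace ℝ (Fin d) × ℝ) :=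
  ν.map fun x => (x, U.indicator (fun _ => (1 : ℝ)) x)

/-- Along the sample sizes `N m`, the clusters of the labellings `c (N m)`, matched by the
permutations `π m`, converge weakly to the sets `U k`. -/
def ClustersConverge {d K : ℕ} (ν : Measure (EuclideanSpace ℝ (Fin d)))
    (x : ℕ → EuclideanSpace ℝ (Fin d)) (c : (n : ℕ) → Fin n → Fin K) (N : ℕ → ℕ)
    (π : ℕ → Equiv.Perm (Fin K)) (U : Fin K → Set (EuclideanSpace ℝ (Fin d))) : Prop :=
  ∀ k, ConvergesWeakly (fun m => discreteGraphMeasure x (c (N m)) (π m k))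
    (graphMeasure ν (U k))

/-! Classification rates -/

open Classical in
/-- Among the sample points lying in `U k`, the fraction lying in the matched cluster `π k`. -/
def classRate {d n K : ℕ} (x : ℕ → EuclideanSpace ℝ (Fin d)) (c : Fin n → Fin K)
    (π : Equiv.Perm (Fin K)) (U : Fin K → Set (EuclideanSpace ℝ (Fin d))) (k : Fin K) : ℝ :=
  ((Finset.univ.filter fun i : Fin n => x i ∈ U k ∧ c i = π k).card : ℝ) /
    ((Finset.univ.filter fun i : Fin n => x i ∈ U k).card : ℝ)

/-- The largest of the class rates, for `K ≥ 1`. -/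
def maxClassRate {d n K : ℕ} (x : ℕ → EuclideanSpace ℝ (Fin d)) (c : Fin n → Fin K)
    (π : Equiv.Perm (Fin K)) (U : Fin K → Set (EuclideanSpace ℝ (Fin d))) : ℝ :=
  ⨆ k, classRate x c π U k

open Classical in
/-- The fraction of all sample points that are correctly classified. -/
def overallRate {d n K : ℕ} (x : ℕ → EuclideanSpace ℝ (Fin d)) (c : Fin n → Fin K)
    (π : Equiv.Perm (Fin K)) (U : Fin K → Set (EuclideanSpace ℝ (Fin d))) : ℝ :=
  ((Finset.univ.filter fun i : Fin n => ∃ k, x i ∈ U k ∧ c i = π k).card : ℝ) / n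

/-- Along the sample sizes `N m`: the largest class rate, each single class rate, and the
overall fraction of correctly classified points all tend to `1`. -/
def ClassificationConsistent {d K : ℕ} (x : ℕ → EuclideanSpace ℝ (Fin d))
    (c : (n : ℕ) → Fin n → Fin K) (N : ℕ → ℕ) (π : ℕ → Equiv.Perm (Fin K))
    (U : Fin K → Set (EuclideanSpace ℝ (Fin d))) : Prop :=
  Tendsto (fun m => maxClassRate x (c (N m)) (π m) U) atTop (𝓝 1) ∧
  (∀ k, Tendsto (fun m => classRate x (c (N m)) (π m) U k) atTop (𝓝 1)) ∧
  Tendsto (fun m => overallRate x (c (N m)) (π m) U) atTop (𝓝 1)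

end GeomModularity

end

open GeomModularity

open GeomModularity

namespace GeomModularity

variable {d K : ℕ}

/-! A class rate is the quotient of two empirical frequencies: that of sample points in `U k` with
the matched label, and that of sample points in `U k`. The overall rate is the sum of the former
over `k`. It therefore suffices that both frequencies tend to the `ν`-mass of `U k`, which is
positive and sums to 1 over `k` (`classificationConsistent_of_tendsto`).

Formally, the joint frequency is the integral of label times indicator of `U k` against the discrete
graph measure, and the graph measure of `U k` integrates it to `ν (U k)`. The integrand is
discontinuous in the point, so weak convergence does not apply directly. If `U k` has null boundary,
the portmanteau theorem handles both frequencies. If `U k` is only measurable but nonrandom, its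
indicator is replaced by a continuous function close in `L¹(ν)`; the strong law bounds the error on
the sample (`tendsto_jointFreq`) and also gives the plain frequency. -/

/-! ### Graph measures and weak convergence -/

/-- Integration against the graph measure of a cluster is an average over the sample points. -/
lemma integral_discreteGraphMeasure {n : ℕ} (x : ℕ → EuclideanSpace ℝ (Fin d))
    (c : Fin n → Fin K) (k : Fin K) (f : EuclideanSpace ℝ (Fin d) × ℝ → ℝ) :
    ∫ z, f z ∂(discreteGraphMeasure x c k) =
      (∑ i : Fin n, f (x i, if c i = k then 1 else 0)) / n := by
  rw [discreteGraphMeasure, integral_smul_measure,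
    integral_finsetSum_measure fun i _ => integrable_dirac (by simp)]
  simp [div_eq_inv_mul]

lemma isProbabilityMeasure_discreteGraphMeasure {n : ℕ} (hn : n ≠ 0)
    (x : ℕ → EuclideanSpace ℝ (Fin d)) (c : Fin n → Fin K) (k : Fin K) :
    IsProbabilityMeasure (discreteGraphMeasure x c k) := by
  constructor
  simp only [discreteGraphMeasure, Measure.smul_apply, Measure.finsetSum_apply, measure_univ,
    Finset.sum_const, Finset.card_univ, Fintype.card_fin, smul_eq_mul, nsmul_eq_mul, mul_one]
  exact ENNReal.inv_mul_cancel (by exact_mod_cast hn) (ENNReal.natCast_ne_top n)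

lemma measurable_graph {U : Set (EuclideanSpace ℝ (Fin d))} (hU : MeasurableSet U) :
    Measurable fun x => (x, U.indicator (fun _ => (1 : ℝ)) x) :=
  measurable_id.prodMk (measurable_const.indicator hU)

/-- Portmanteau theorem for `ConvergesWeakly`, when the approximating measures are eventually
probability measures. -/
lemma ConvergesWeakly.tendsto_measureReal {S : Type*} [TopologicalSpace S] [MeasurableSpace S]
    [OpensMeasurableSpace S] [HasOuterApproxClosed S] {γs : ℕ → Measure S} {γ : Measure S}
    [IsProbabilityMeasure γ] (h : ConvergesWeakly γs γ)
    (hγs : ∀ m, IsProbabilityMeasure (γs (m + 1))) {s : Set S} (hs : γ (frontier s) = 0) :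
    Tendsto (fun m => (γs m).real s) atTop (𝓝 (γ.real s)) := by
  -- The first measure may come from an empty sample and then be zero, so the sequence is shifted by
  -- one.
  rw [← tendsto_add_atTop_iff_nat 1]
  let p : ℕ → ProbabilityMeasure S := fun m => ⟨γs (m + 1), hγs m⟩
  let q : ProbabilityMeasure S := ⟨γ, inferInstance⟩
  have hpq : Tendsto p atTop (𝓝 q) :=
    ProbabilityMeasure.tendsto_iff_forall_integral_tendsto.2 fun f =>
      (tendsto_add_atTop_iff_nat 1).2 (h f)
  have := ProbabilityMeasure.tendsto_measure_of_null_frontier_of_tendsto' hpq (E := s) hs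
  exact (ENNReal.tendsto_toReal (measure_ne_top γ s)).comp this

/-! ### Empirical frequencies and classification rates -/

/-- Number of sample points in `U` that carry the label `k`, divided by the sample size. -/
noncomputable def jointFreq {n : ℕ} (x : ℕ → EuclideanSpace ℝ (Fin d)) (c : Fin n → Fin K)
    (U : Set (EuclideanSpace ℝ (Fin d))) (k : Fin K) : ℝ :=
  (∑ i : Fin n, U.indicator (fun _ => (1 : ℝ)) (x i) * if c i = k then 1 else 0) / n

/-- Fraction of the sample points that lie in `U`. -/
noncomputable def freq (x : ℕ → EuclideanSpace ℝ (Fin d)) (n : ℕ) (U : Set (EuclideanSpace ℝ (Fin d))) : ℝ :=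
  (∑ i ∈ Finset.range n, U.indicator (fun _ => (1 : ℝ)) (x i)) / n

open Classical in
lemma jointFreq_eq_card_div {n : ℕ} (x : ℕ → EuclideanSpace ℝ (Fin d)) (c : Fin n → Fin K)
    (U : Set (EuclideanSpace ℝ (Fin d))) (k : Fin K) :
    jointFreq x c U k =
      ((Finset.univ.filter fun i : Fin n => x i ∈ U ∧ c i = k).card : ℝ) / n := by
  rw [jointFreq, Finset.card_filter, Nat.cast_sum]
  congr 1
  refine Finset.sum_congr rfl fun i _ => ?_
  by_cases h : x i ∈ U <;> by_cases h' : c i = k <;> simp [h, h']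

open Classical in
lemma freq_eq_card_div (n : ℕ) (x : ℕ → EuclideanSpace ℝ (Fin d))
    (U : Set (EuclideanSpace ℝ (Fin d))) :
    freq x n U = ((Finset.univ.filter fun i : Fin n => x i ∈ U).card : ℝ) / n := by
  rw [freq, Finset.card_filter, Nat.cast_sum,
    Finset.sum_range fun i => U.indicator (fun _ => (1 : ℝ)) (x i)]
  congr 1
  refine Finset.sum_congr rfl fun i _ => ?_
  by_cases h : x i ∈ U <;> simp [h]

lemma classRate_eq {n : ℕ} (x : ℕ → EuclideanSpace ℝ (Fin d)) (c : Fin n → Fin K)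
    (π : Equiv.Perm (Fin K)) (U : Fin K → Set (EuclideanSpace ℝ (Fin d))) (k : Fin K)
    (hn : n ≠ 0) :
    classRate x c π U k = jointFreq x c (U k) (π k) / freq x n (U k) := by
  rw [jointFreq_eq_card_div, freq_eq_card_div,
    div_div_div_cancel_right₀ (by exact_mod_cast hn), classRate]

lemma classRate_le_one {n : ℕ} (x : ℕ → EuclideanSpace ℝ (Fin d)) (c : Fin n → Fin K)
    (π : Equiv.Perm (Fin K)) (U : Fin K → Set (EuclideanSpace ℝ (Fin d))) (k : Fin K) :
    classRate x c π U k ≤ 1 := by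
  classical
  refine div_le_one_of_le₀ ?_ (Nat.cast_nonneg _)
  exact_mod_cast Finset.card_le_card fun i hi => by
    simp only [Finset.mem_filter, Finset.mem_univ, true_and] at hi ⊢
    exact hi.1

lemma overallRate_eq {n : ℕ} (x : ℕ → EuclideanSpace ℝ (Fin d)) (c : Fin n → Fin K)
    (π : Equiv.Perm (Fin K)) {U : Fin K → Set (EuclideanSpace ℝ (Fin d))}
    (hU : ∀ k l, k ≠ l → Disjoint (U k) (U l)) :
    overallRate x c π U = ∑ k, jointFreq x c (U k) (π k) := by
  classical
  simp_rw [jointFreq_eq_card_div, ← Finset.sum_div, overallRate]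
  congr 1
  rw [← Nat.cast_sum, ← Finset.card_biUnion]
  · congr 2
    ext i
    simp
  · intro k _ l _ hkl
    refine Finset.disjoint_left.2 fun i hi hi' => ?_
    simp only [Finset.mem_filter, Finset.mem_univ, true_and] at hi hi'
    exact Set.disjoint_left.1 (hU k l hkl) hi.1 hi'.1

/-- Consistency of the classification follows from the convergence of the frequencies of the
sets `U k` and of their intersections with the matched clusters. -/
lemma classificationConsistent_of_tendsto (hK : 1 ≤ K)
    {ν : Measure (EuclideanSpace ℝ (Fin d))}
    {x : ℕ → EuclideanSpace ℝ (Fin d)} {c : (n : ℕ) → Fin n → Fin K} {N : ℕ → ℕ}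
    {π : ℕ → Equiv.Perm (Fin K)} {U : Fin K → Set (EuclideanSpace ℝ (Fin d))}
    (hN : StrictMono N) (hdisj : ∀ k l, k ≠ l → Disjoint (U k) (U l))
    (hpos : ∀ k, ν.real (U k) ≠ 0) (hsum : ∑ k, ν.real (U k) = 1)
    (hfreq : ∀ k, Tendsto (fun m => freq x (N m) (U k)) atTop (𝓝 (ν.real (U k))))
    (hjoint : ∀ k, Tendsto (fun m => jointFreq x (c (N m)) (U k) (π m k)) atTop
      (𝓝 (ν.real (U k)))) :
    ClassificationConsistent x c N π U := by
  have hrate : ∀ k, Tendsto (fun m => classRate x (c (N m)) (π m) U k) atTop (𝓝 1) := by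
    intro k
    have h := (hjoint k).div (hfreq k) (hpos k)
    rw [div_self (hpos k)] at h
    refine h.congr' ?_
    -- Strict monotonicity gives `m ≤ N m`, so samples are nonempty from `m = 1` on.
    filter_upwards [eventually_ge_atTop 1] with m hm
    exact (classRate_eq x _ _ U k (by have := hN.le_apply (x := m); omega)).symm
  have : Nonempty (Fin K) := ⟨⟨0, hK⟩⟩
  refine ⟨?_, hrate, ?_⟩
  -- The maximum is squeezed between the rate of one class and 1.
  · refine tendsto_of_tendsto_of_tendsto_of_le_of_le (hrate ⟨0, hK⟩) tendsto_const_nhds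
      (fun m => ?_) (fun m => ?_)
    · exact le_ciSup (f := fun k => classRate x (c (N m)) (π m) U k)
        (Set.finite_range _).bddAbove _
    · exact ciSup_le fun k => classRate_le_one x _ _ U k
  · simp_rw [overallRate_eq x _ _ hdisj]
    rw [← hsum]
    exact tendsto_finsetSum _ fun k _ => hjoint k

/-! ### Frequencies as masses of product sets -/

lemma measureReal_discreteGraphMeasure_univ {n : ℕ} (x : ℕ → EuclideanSpace ℝ (Fin d))
    (c : Fin n → Fin K) (k : Fin K) {U : Set (EuclideanSpace ℝ (Fin d))}
    (hU : MeasurableSet U) :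
    (discreteGraphMeasure x c k).real (U ×ˢ univ) = freq x n U := by
  rw [← integral_indicator_one (hU.prod .univ), integral_discreteGraphMeasure, freq,
    Finset.sum_range fun i => U.indicator (fun _ => (1 : ℝ)) (x i)]
  congr 1
  refine Finset.sum_congr rfl fun i _ => ?_
  by_cases h : x i ∈ U <;> simp [h]

/-- Labels are 0 or 1, so the threshold 1/2 selects exactly the points of the cluster. -/
lemma measureReal_discreteGraphMeasure_Ioi {n : ℕ} (x : ℕ → EuclideanSpace ℝ (Fin d))
    (c : Fin n → Fin K) (k : Fin K) {U : Set (EuclideanSpace ℝ (Fin d))}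
    (hU : MeasurableSet U) :
    (discreteGraphMeasure x c k).real (U ×ˢ Ioi (1 / 2)) = jointFreq x c U k := by
  rw [← integral_indicator_one (hU.prod measurableSet_Ioi), integral_discreteGraphMeasure,
    jointFreq]
  congr 1
  refine Finset.sum_congr rfl fun i _ => ?_
  by_cases h : x i ∈ U <;> by_cases h' : c i = k <;> norm_num [h, h', indicator]

lemma graphMeasure_frontier_univ {ν : Measure (EuclideanSpace ℝ (Fin d))}
    {U : Set (EuclideanSpace ℝ (Fin d))} (hU : MeasurableSet U) (h0 : ν (frontier U) = 0) :
    graphMeasure ν U (frontier (U ×ˢ univ)) = 0 := by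
  rw [graphMeasure, Measure.map_apply (measurable_graph hU) isClosed_frontier.measurableSet]
  refine measure_mono_null (fun y hy => ?_) h0
  simpa [frontier_prod_eq] using hy

/-- An indicator never takes the value 1/2, so the graph can meet the frontier of the product only
over `frontier U`. -/
lemma graphMeasure_frontier_Ioi {ν : Measure (EuclideanSpace ℝ (Fin d))}
    {U : Set (EuclideanSpace ℝ (Fin d))} (hU : MeasurableSet U) (h0 : ν (frontier U) = 0) :
    graphMeasure ν U (frontier (U ×ˢ Ioi (1 / 2))) = 0 := by
  rw [graphMeasure, Measure.map_apply (measurable_graph hU) isClosed_frontier.measurableSet]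
  refine measure_mono_null (fun y hy => ?_) h0
  simp only [frontier_prod_eq, mem_preimage, mem_union, mem_prod, frontier_Ioi,
    mem_singleton_iff] at hy
  rcases hy with hy | hy
  · by_cases h : y ∈ U <;> norm_num [h] at hy
  · exact hy.1

lemma graphMeasure_real_univ {ν : Measure (EuclideanSpace ℝ (Fin d))}
    {U : Set (EuclideanSpace ℝ (Fin d))} (hU : MeasurableSet U) :
    (graphMeasure ν U).real (U ×ˢ univ) = ν.real U := by
  rw [graphMeasure, map_measureReal_apply (measurable_graph hU) (hU.prod .univ)]
  congr 1
  ext y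
  simp

lemma graphMeasure_real_Ioi {ν : Measure (EuclideanSpace ℝ (Fin d))}
    {U : Set (EuclideanSpace ℝ (Fin d))} (hU : MeasurableSet U) :
    (graphMeasure ν U).real (U ×ˢ Ioi (1 / 2)) = ν.real U := by
  rw [graphMeasure, map_measureReal_apply (measurable_graph hU) (hU.prod measurableSet_Ioi)]
  congr 1
  ext y
  by_cases h : y ∈ U <;> norm_num [h]

lemma isProbabilityMeasure_graphMeasure {ν : Measure (EuclideanSpace ℝ (Fin d))}
    [IsProbabilityMeasure ν] {U : Set (EuclideanSpace ℝ (Fin d))} (hU : MeasurableSet U) :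
    IsProbabilityMeasure (graphMeasure ν U) :=
  Measure.isProbabilityMeasure_map (measurable_graph hU).aemeasurable

/-! ### Approximation of indicators by continuous functions -/

/-- A bounded continuous function of the point, times the truncation of the label to `[0, 1]`. -/
noncomputable def clampedProduct (g : EuclideanSpace ℝ (Fin d) →ᵇ ℝ) :
    EuclideanSpace ℝ (Fin d) × ℝ →ᵇ ℝ :=
  BoundedContinuousFunction.ofNormedAddCommGroup (fun z => g z.1 * max 0 (min z.2 1))
    (by fun_prop) ‖g‖ fun z => by
      rw [norm_mul]
      refine (mul_le_of_le_one_right (norm_nonneg _) ?_).trans (g.norm_coe_le_norm z.1)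
      rw [Real.norm_of_nonneg (le_max_left _ _)]
      exact max_le zero_le_one (min_le_right _ _)

lemma clampedProduct_apply (g : EuclideanSpace ℝ (Fin d) →ᵇ ℝ)
    (z : EuclideanSpace ℝ (Fin d) × ℝ) :
    clampedProduct g z = g z.1 * max 0 (min z.2 1) := rfl

lemma integral_clampedProduct_graphMeasure {ν : Measure (EuclideanSpace ℝ (Fin d))}
    {U : Set (EuclideanSpace ℝ (Fin d))} (hU : MeasurableSet U)
    (g : EuclideanSpace ℝ (Fin d) →ᵇ ℝ) :
    ∫ z, clampedProduct g z ∂(graphMeasure ν U) =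
      ∫ y, g y * U.indicator (fun _ => (1 : ℝ)) y ∂ν := by
  rw [graphMeasure, integral_map (measurable_graph hU).aemeasurable
    (clampedProduct g).continuous.aestronglyMeasurable]
  congr 1
  ext y
  by_cases h : y ∈ U <;> simp [h, clampedProduct_apply]

/-- Truncation fixes the labels 0 and 1, so each term changes by at most the distance of `g` to the
indicator. The bound does not see the labels, hence the law of large numbers controls it for any
clustering. -/
lemma abs_jointFreq_sub_le {n : ℕ} (x : ℕ → EuclideanSpace ℝ (Fin d)) (c : Fin n → Fin K)
    (U : Set (EuclideanSpace ℝ (Fin d))) (k : Fin K) (g : EuclideanSpace ℝ (Fin d) →ᵇ ℝ) :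
    |jointFreq x c U k - ∫ z, clampedProduct g z ∂(discreteGraphMeasure x c k)| ≤
      (∑ i ∈ Finset.range n, ‖U.indicator (fun _ => (1 : ℝ)) (x i) - g (x i)‖) / n := by
  rw [integral_discreteGraphMeasure, jointFreq, ← sub_div, abs_div, Nat.abs_cast,
    ← Finset.sum_sub_distrib,
    Finset.sum_range fun i => ‖U.indicator (fun _ => (1 : ℝ)) (x i) - g (x i)‖]
  refine div_le_div_of_nonneg_right ((Finset.abs_sum_le_sum_abs _ _).trans
    (Finset.sum_le_sum fun i _ => ?_)) (Nat.cast_nonneg _)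
  by_cases h : c i = k <;> simp [h, clampedProduct_apply]

/-- Convergence of the joint frequencies with `U`, if the law of large numbers holds for the
distances of the indicator of `U` to continuous functions that approximate it in `L¹`. -/
lemma tendsto_jointFreq {ν : Measure (EuclideanSpace ℝ (Fin d))} [IsProbabilityMeasure ν]
    {x : ℕ → EuclideanSpace ℝ (Fin d)} {c : (n : ℕ) → Fin n → Fin K} {N : ℕ → ℕ}
    {l : ℕ → Fin K} {U : Set (EuclideanSpace ℝ (Fin d))} (hU : MeasurableSet U)
    (hN : Tendsto N atTop atTop)
    (hconv : ConvergesWeakly (fun m => discreteGraphMeasure x (c (N m)) (l m))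
      (graphMeasure ν U))
    {g : ℕ → EuclideanSpace ℝ (Fin d) →ᵇ ℝ}
    (hg : ∀ j, ∫ y, ‖U.indicator (fun _ => (1 : ℝ)) y - g j y‖ ∂ν ≤ 1 / ((j : ℝ) + 1))
    (hlln : ∀ j, Tendsto (fun n : ℕ =>
      (∑ i ∈ Finset.range n, ‖U.indicator (fun _ => (1 : ℝ)) (x i) - g j (x i)‖) / n) atTop
      (𝓝 (∫ y, ‖U.indicator (fun _ => (1 : ℝ)) y - g j y‖ ∂ν))) :
    Tendsto (fun m => jointFreq x (c (N m)) U (l m)) atTop (𝓝 (ν.real U)) := by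
  rw [Metric.tendsto_nhds]
  intro δ hδ
  -- Three errors below `δ / 4` each: `g j` for the indicator on the sample, weak convergence, and
  -- `g j` for the indicator in the limit.
  obtain ⟨j, hj⟩ := exists_nat_one_div_lt (show 0 < δ / 4 by positivity)
  have hint : Integrable (U.indicator fun _ => (1 : ℝ)) ν :=
    (integrable_const _).indicator hU
  have hgint : Integrable (g j) ν := (g j).integrable ν
  have hlim : |∫ z, clampedProduct (g j) z ∂(graphMeasure ν U) - ν.real U| < δ / 4 := by
    refine lt_of_le_of_lt ?_ ((hg j).trans_lt hj)
    rw [integral_clampedProduct_graphMeasure hU, ← integral_indicator_one hU]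
    have hmul : Integrable (fun y => g j y * U.indicator (fun _ => (1 : ℝ)) y) ν := by
      refine (hgint.indicator hU).congr (.of_forall fun y => ?_)
      by_cases h : y ∈ U <;> simp [h]
    rw [← integral_sub hmul (by simpa [Pi.one_def] using hint)]
    refine (norm_integral_le_integral_norm _).trans (integral_mono
      (hmul.sub (by simpa [Pi.one_def] using hint)).norm (hint.sub hgint).norm fun y => ?_)
    by_cases h : y ∈ U <;> simp [h, abs_sub_comm]
  have h1 := ((hlln j).comp hN).eventually_lt_const ((hg j).trans_lt hj)
  have h2 := Metric.tendsto_nhds.1 (hconv (clampedProduct (g j))) (δ / 4) (by positivity)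
  filter_upwards [h1, h2] with m h1 h2
  have h3 := (abs_jointFreq_sub_le x (c (N m)) U (l m) (g j)).trans_lt h1
  rw [Real.dist_eq] at h2 ⊢
  rw [abs_lt] at *
  constructor <;> linarith [h2.1, h2.2, h3.1, h3.2, hlim.1, hlim.2]

/-! ### Law of large numbers and masses of the limit sets -/

/-- The strong law of large numbers for a function of the sample points. -/
lemma ae_tendsto_average {E Ω : Type*} [MeasurableSpace E] [MeasurableSpace Ω] {P : Measure Ω}
    {X : ℕ → Ω → E} {ν : Measure E} (hXm : ∀ i, Measurable (X i))
    (hXlaw : ∀ i, P.map (X i) = ν) (hXind : iIndepFun X P) {φ : E → ℝ} (hφ : Measurable φ)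
    (hint : Integrable φ ν) :
    ∀ᵐ ω ∂P, Tendsto (fun n : ℕ => (∑ i ∈ Finset.range n, φ (X i ω)) / n) atTop
      (𝓝 (∫ y, φ y ∂ν)) := by
  have h := strong_law_ae_real (μ := P) (fun i ω => φ (X i ω))
    ((hXlaw 0 ▸ hint : Integrable φ (P.map (X 0))).comp_measurable (hXm 0))
    (fun i j hij => (hXind.indepFun hij).comp hφ hφ)
    (fun i => IdentDistrib.comp
      ⟨(hXm i).aemeasurable, (hXm 0).aemeasurable, by rw [hXlaw i, hXlaw 0]⟩ hφ)
  rwa [← hXlaw 0, integral_map (hXm 0).aemeasurable hφ.aestronglyMeasurable]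

lemma groundMeasure_absolutelyContinuous (D : Set (EuclideanSpace ℝ (Fin d)))
    (ρ : EuclideanSpace ℝ (Fin d) → ℝ) : groundMeasure D ρ ≪ volume.restrict D :=
  withDensity_absolutelyContinuous _ _

/-- Since `ρ` is positive on `D`, a `ν`-null `U k` would be Lebesgue null in `D`, hence null for the
balance measure, which gives it mass `1 / K`. -/
lemma groundMeasure_real_ne_zero {D : Set (EuclideanSpace ℝ (Fin d))}
    (hD : IsAdmissibleDomain D) {ρ : EuclideanSpace ℝ (Fin d) → ℝ}
    (hρ : IsAdmissibleDensity D ρ) {α : ℝ} {U : Fin K → Set (EuclideanSpace ℝ (Fin d))}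
    (hU : IsBalancedPartition D (balanceMeasure D ρ α) U) (k : Fin K) :
    (groundMeasure D ρ).real (U k) ≠ 0 := by
  have := hρ.isProbabilityMeasure
  intro h0
  rw [measureReal_eq_zero_iff] at h0
  have hac : volume.restrict D ≪ groundMeasure D ρ := by
    refine withDensity_absolutelyContinuous' ?_ ?_
    · obtain ⟨L, hL⟩ := hρ.lipschitz
      exact (hL.continuousOn.aemeasurable hD.isOpen.measurableSet).ennreal_ofReal
    · obtain ⟨a, b, ha, hab⟩ := hρ.bounds
      filter_upwards [ae_restrict_mem hD.isOpen.measurableSet] with y hy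
      simpa using ha.trans_le (hab y hy).1
  have h1 := hU.balanced k
  -- The normalising factor needs no finiteness check: in `ℝ≥0∞` any multiple of 0 is 0.
  rw [balanceMeasure, Measure.smul_apply, withDensity_absolutelyContinuous _ _ (hac h0),
    smul_zero] at h1
  simp [eq_comm] at h1

lemma sum_groundMeasure_real {D : Set (EuclideanSpace ℝ (Fin d))}
    (hD : IsAdmissibleDomain D) {ρ : EuclideanSpace ℝ (Fin d) → ℝ}
    (hρ : IsAdmissibleDensity D ρ) {μ : Measure (EuclideanSpace ℝ (Fin d))}
    {U : Fin K → Set (EuclideanSpace ℝ (Fin d))} (hU : IsBalancedPartition D μ U) :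
    ∑ k, (groundMeasure D ρ).real (U k) = 1 := by
  have := hρ.isProbabilityMeasure
  rw [← measureReal_iUnion_fintype (fun k l hkl => hU.disjoint k l hkl) hU.measurableSet,
    hU.iUnion_eq]
  have h : (groundMeasure D ρ).real Dᶜ = 0 := by
    rw [measureReal_eq_zero_iff]
    exact groundMeasure_absolutelyContinuous D ρ (by
      rw [Measure.restrict_apply hD.isOpen.measurableSet.compl]; simp)
  rw [probReal_compl_eq_one_sub hD.isOpen.measurableSet] at h
  linarith

end GeomModularity

theorem corollary2p2 {d K : ℕ} (hd : 1 ≤ d) (hK : 1 ≤ K)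
    {D : Set (EuclideanSpace ℝ (Fin d))} (hD : IsAdmissibleDomain D)
    {ρ : EuclideanSpace ℝ (Fin d) → ℝ} (hρ : IsAdmissibleDensity D ρ)
    {η : EuclideanSpace ℝ (Fin d) → ℝ} (hη : IsAdmissibleKernel η)
    {α : ℝ} {ε : ℕ → ℝ} (hε : IsAdmissibleScale d α ε)
    -- the i.i.d. sample
    {Ω : Type*} [MeasurableSpace Ω] {P : Measure Ω} [IsProbabilityMeasure P]
    {X : ℕ → Ω → EuclideanSpace ℝ (Fin d)} (hXm : ∀ i, Measurable (X i))
    (hXlaw : ∀ i, P.map (X i) = groundMeasure D ρ) (hXind : iIndepFun X P)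
    -- a subsequence of optimal partitions into at most `K` clusters, with matching permutations
    (c : Ω → (n : ℕ) → Fin n → Fin K) (N : Ω → ℕ → ℕ) (π : Ω → ℕ → Equiv.Perm (Fin K))
    (hN : ∀ᵐ ω ∂P, StrictMono (N ω))
    (hopt : ∀ᵐ ω ∂P, ∀ m, IsOptimalClustering α
      (geometricWeights η (ε (N ω m)) (fun i => X i ω) (N ω m)) (c ω (N ω m))) :
    -- the limit is a fixed solution of the continuum problem
    (∀ U : Fin K → Set (EuclideanSpace ℝ (Fin d)),
      IsOptimalPartition D (fun x => ρ x ^ 2) (balanceMeasure D ρ α) U →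
      (∀ᵐ ω ∂P, ClustersConverge (groundMeasure D ρ) (fun i => X i ω) (c ω) (N ω) (π ω) U) →
      ∀ᵐ ω ∂P, ClassificationConsistent (fun i => X i ω) (c ω) (N ω) (π ω) U) ∧
    -- the limit is a solution that depends on the realization and has null boundaries
    (∀ U : Ω → Fin K → Set (EuclideanSpace ℝ (Fin d)),
      (∀ᵐ ω ∂P, IsOptimalPartition D (fun x => ρ x ^ 2) (balanceMeasure D ρ α) (U ω)) →
      (∀ᵐ ω ∂P, ∀ k, groundMeasure D ρ (frontier (U ω k)) = 0) →
      (∀ᵐ ω ∂P,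
        ClustersConverge (groundMeasure D ρ) (fun i => X i ω) (c ω) (N ω) (π ω) (U ω)) →
      ∀ᵐ ω ∂P, ClassificationConsistent (fun i => X i ω) (c ω) (N ω) (π ω) (U ω)) := by

  have hν := hρ.isProbabilityMeasure
  refine ⟨fun U hU hconv => ?_, fun U hU hfr hconv => ?_⟩
  · have hUm := hU.1.measurableSet
    have hind : ∀ k, Integrable ((U k).indicator fun _ => (1 : ℝ)) (groundMeasure D ρ) :=
      fun k => (integrable_const _).indicator (hUm k)
    -- As `U` is nonrandom, these countably many functions are chosen before `ω`, so one null set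
    -- serves for all the laws of large numbers.
    have hex : ∀ (k : Fin K) (j : ℕ), ∃ g : EuclideanSpace ℝ (Fin d) →ᵇ ℝ,
        ∫ y, ‖(U k).indicator (fun _ => (1 : ℝ)) y - g y‖ ∂(groundMeasure D ρ) ≤
          1 / ((j : ℝ) + 1) := fun k j => by
      obtain ⟨g, hg, -⟩ := (hind k).exists_boundedContinuous_integral_sub_le
        (show (0 : ℝ) < 1 / ((j : ℝ) + 1) by positivity)
      exact ⟨g, hg⟩
    choose g hg using hex
    have hfreq : ∀ᵐ ω ∂P, ∀ k, Tendsto (fun n => freq (fun i => X i ω) n (U k)) atTop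
        (𝓝 ((groundMeasure D ρ).real (U k))) := by
      refine ae_all_iff.2 fun k => ?_
      rw [← integral_indicator_one (hUm k)]
      exact ae_tendsto_average hXm hXlaw hXind (measurable_const.indicator (hUm k)) (hind k)
    have hlln : ∀ᵐ ω ∂P, ∀ k j, Tendsto (fun n : ℕ => (∑ i ∈ Finset.range n,
        ‖(U k).indicator (fun _ => (1 : ℝ)) (X i ω) - g k j (X i ω)‖) / n) atTop
        (𝓝 (∫ y, ‖(U k).indicator (fun _ => (1 : ℝ)) y - g k j y‖ ∂(groundMeasure D ρ))) :=
      ae_all_iff.2 fun k => ae_all_iff.2 fun j => ae_tendsto_average hXm hXlaw hXind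
        (φ := fun y => ‖(U k).indicator (fun _ => (1 : ℝ)) y - g k j y‖)
        ((measurable_const.indicator (hUm k)).sub (g k j).continuous.measurable).norm
        ((hind k).sub ((g k j).integrable _)).norm
    filter_upwards [hN, hconv, hfreq, hlln] with ω hN hconv hfreq hlln
    exact classificationConsistent_of_tendsto hK hN hU.1.disjoint
      (groundMeasure_real_ne_zero hD hρ hU.1) (sum_groundMeasure_real hD hρ hU.1)
      (fun k => (hfreq k).comp hN.tendsto_atTop)
      (fun k => tendsto_jointFreq (hUm k) hN.tendsto_atTop (hconv k) (hg k) (hlln k))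
  -- Here `U ω` depends on the sample and the strong law is not available; the argument is
  -- deterministic for each `ω`.
  · filter_upwards [hN, hU, hfr, hconv] with ω hN hU hfr hconv
    have hUm := hU.1.measurableSet
    have hprob : ∀ k m, IsProbabilityMeasure (discreteGraphMeasure (fun i => X i ω)
        (c ω (N ω (m + 1))) (π ω (m + 1) k)) := fun k m =>
      isProbabilityMeasure_discreteGraphMeasure
        (by have := hN.le_apply (x := m + 1); omega) _ _ _
    have hprob' : ∀ k, IsProbabilityMeasure (graphMeasure (groundMeasure D ρ) (U ω k)) :=
      fun k => isProbabilityMeasure_graphMeasure (hUm k)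
    refine classificationConsistent_of_tendsto hK hN hU.1.disjoint
      (groundMeasure_real_ne_zero hD hρ hU.1) (sum_groundMeasure_real hD hρ hU.1)
      (fun k => ?_) (fun k => ?_)
    · simpa only [measureReal_discreteGraphMeasure_univ _ _ _ (hUm k),
        graphMeasure_real_univ (hUm k)] using
        (hconv k).tendsto_measureReal (hprob k) (graphMeasure_frontier_univ (hUm k) (hfr k))
    · simpa only [measureReal_discreteGraphMeasure_Ioi _ _ _ (hUm k),
        graphMeasure_real_Ioi (hUm k)] using
        (hconv k).tendsto_measureReal (hprob k) (graphMeasure_frontier_Ioi (hUm k) (hfr k))
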